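/- A weighted graph $G=(V,w)$ is a vertex set $V$ with a symmetric function $w:V\times V\to[0,\infty)$ such that $w_x:=\sum_{y} w(x,y)<\infty$ for every vertex $x$; its edges are the unordered pairs $\{x,y\}$ (loops $x=y$ allowed) with $w(x,y)>0$. Let $G$ be an infinite weighted graph and let $o$ be a vertex with $w_o>0$. Write $|v|$ for the graph distance from $o$ to $v$. For $n\ge 0$ let $w_n$ be the total weight of the edges at distance $n$ from $o$, where the distance from $o$ to an edge $\{x,y\}$ is $\min(|x|,|y|)$. Let $g_0=\limsup_{n\to\infty} w_n^{1/n}\in[0,\infty]$ be the exponential upper growth of $G$, and let $g=\max(g_0,1)$. Let $(X_k)_{k\ge0}$ be the random walk on $G$ started at $o$, that is, the Markov chain with $X_0=o$ almost surely and transition probabilities $p(x,y)=w(x,y)/w_x$. Then $$\limsup_{k\to\infty}\frac{|X_k|}{k}\le\frac{g-1}{g+1}\quad\text{almost surely},$$ where the right-hand side is read as its limit $1$ if $g=\infty$. -/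

import Mathlib

open MeasureTheory Filter
open scoped NNReal ENNReal

/-- A weighted graph on the vertex set `V`: a symmetric nonnegative weight function whose support is
the edge set (loops are allowed).  The total weight of the edges incident to a vertex is finite, so
that the random walk makes sense; vertices may have infinitely many neighbours. -/
structure WeightedGraph (V : Type*) where
  /-- the edge weights -/
  w : V → V → ℝ≥0
  symm : ∀ x y, w x y = w y x
  finite_weight : ∀ x, ∑' y, (w x y : ℝ≥0∞) ≠ ⊤

namespace WeightedGraph

variable {V : Type*} (G : WeightedGraph V)

/-- The weight `w_x` of a vertex: the sum of the weights of the edges incident to it. -/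
noncomputable def vertexWeight (x : V) : ℝ≥0∞ := ∑' y, (G.w x y : ℝ≥0∞)

/-- The underlying simple graph: the support of `w`, without the loops (which do not affect
distances). -/
def toSimpleGraph : SimpleGraph V where
  Adj x y := x ≠ y ∧ G.w x y ≠ 0
  symm := ⟨fun x y h => ⟨h.1.symm, by rw [G.symm y x]; exact h.2⟩⟩
  loopless := ⟨fun _ h => h.1 rfl⟩

/-- The graph distance between two vertices (infinite if there is no path between them). -/
noncomputable def distance (x y : V) : ℕ∞ := G.toSimpleGraph.edist x y

/-- The weight of an unordered pair of vertices (zero if the pair is not an edge). -/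
def edgeWeight : Sym2 V → ℝ≥0∞ :=
  Sym2.lift ⟨fun x y => (G.w x y : ℝ≥0∞), fun x y => congrArg _ (G.symm x y)⟩

/-- The distance from `o` to an edge: the distance from `o` to its nearer endpoint. -/
noncomputable def edgeDistance (o : V) : Sym2 V → ℕ∞ :=
  Sym2.lift ⟨fun x y => min (G.distance o x) (G.distance o y), fun _ _ => min_comm _ _⟩

/-- The total weight `w_n` of the edges at distance `n` from `o`. -/
noncomputable def levelWeight (o : V) (n : ℕ) : ℝ≥0∞ :=
  ∑' e : {e : Sym2 V // G.edgeDistance o e = (n : ℕ∞)}, G.edgeWeight e.1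

/-- The exponential upper growth `limsup w_n ^ (1 / n)`, an element of `[0, ∞]`. -/
noncomputable def upperGrowth (o : V) : ℝ≥0∞ :=
  limsup (fun n : ℕ => G.levelWeight o n ^ (1 / (n : ℝ))) atTop

/-- The probability that the walk at `x` moves to `y` in one step. -/
noncomputable def transitionProb (x y : V) : ℝ≥0∞ := (G.w x y : ℝ≥0∞) / G.vertexWeight x

/-- The process `X` on the probability space `(Ω, P)` is the random walk on `G` started at `o`:
a Markov chain with transition probabilities `w x y / w_x` that starts at `o`. -/
structure IsRandomWalk {Ω : Type*} [MeasurableSpace Ω] (P : Measure Ω) (o : V)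
    (X : ℕ → Ω → V) : Prop where
  measurableSet_eq : ∀ k x, MeasurableSet {ω | X k ω = x}
  start : P {ω | X 0 ω = o} = 1
  step : ∀ (n : ℕ) (x : ℕ → V) (y : V),
    P {ω | (∀ i ≤ n, X i ω = x i) ∧ X (n + 1) ω = y}
      = P {ω | ∀ i ≤ n, X i ω = x i} * G.transitionProb (x n) y

end WeightedGraph

/-- The quantity `(g - 1) / (g + 1)` for `1 ≤ g ≤ ∞`, equal to its limit `1` at `g = ∞`. -/
noncomputable def speedBound (g : ℝ≥0∞) : ℝ≥0∞ := if g = ⊤ then 1 else (g - 1) / (g + 1)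

/-!
Stop the walk when it leaves a finite set `B` of vertices at distance at most `m` from `o`, and let
`T` be the exit time. The exit function `h x = E_x[exp (-θ T)]` and the Green density `v` from `o`
define a flow `f(x, y) = w(x, y) v(x) h(y)` from `o` to the boundary. It has three properties.
* It carries the mass `h o` from level `0` to level `m`: the sum of `f(x, y) (|y| - |x|)` is
  `m h(o)`.
* Its total is at most `-h(o) log h(o) / θ`, because by Jensen's inequality `φ = -h log h` loses at
  least `θ h` per discounted step of the walk.
* The ratio `f(x, y) / f(y, x)` is a quotient of values of `v / h`, so that the entropy of `f`
  relative to its reversal is a boundary term. Jensen's inequality bounds it by the logarithm of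
  the weight of the boundary edges, which is at most `γ m` if `w_m ≤ exp (γ m)`.

On each edge the tangent line inequality of `cosh` bounds the net flux by the entropy and the total
flow. Summing over the edges gives
`(γ + sinh γ) m ≤ γ m + (2 + (cosh γ - 1) / θ) (-log h(o)) + O(1)`, an upper bound for `h o`
that does not depend on `B`. Since `P(|X_k| > m) ≤ exp (θ k) h(o)`, a small `θ` shows that
`P(|X_k| > a k)` decays exponentially as soon as `a > (cosh γ - 1) / sinh γ = (q - 1) / (q + 1)`,
where `q = exp γ`. By the Borel–Cantelli lemma the upper speed is at most `a` almost surely.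
-/

section Analysis

theorem cosh_add_mul_sinh_le_cosh_add (u r : ℝ) :
    Real.cosh u + r * Real.sinh u ≤ Real.cosh (u + r) := by
  have hpos := mul_le_mul_of_nonneg_left (Real.add_one_le_exp r) (Real.exp_pos u).le
  have hneg := mul_le_mul_of_nonneg_left (Real.add_one_le_exp (-r)) (Real.exp_pos (-u)).le
  rw [← Real.exp_add] at hpos hneg
  rw [Real.cosh_eq, Real.sinh_eq, Real.cosh_eq, neg_add]
  linarith

theorem abs_add_sinh_mul_sinh_le (γ u : ℝ) :
    |(γ + Real.sinh γ) * Real.sinh u|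
      ≤ 2 * u * Real.sinh u + (Real.cosh γ - 1) * Real.cosh u := by
  -- the tangent line of `cosh` at `t`, evaluated at `t + (γ - 2 * t) = γ - t`
  have tangent (t : ℝ) : (γ + Real.sinh γ) * Real.sinh t
      ≤ 2 * t * Real.sinh t + (Real.cosh γ - 1) * Real.cosh t := by
    have h := cosh_add_mul_sinh_le_cosh_add t (γ - 2 * t)
    rw [show t + (γ - 2 * t) = γ - t by ring, Real.cosh_sub] at h
    linarith
  have hneg := tangent (-u)
  rw [Real.sinh_neg, Real.cosh_neg] at hneg
  exact abs_le'.mpr ⟨tangent u, by linarith⟩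

theorem flux_le_entropy_add_total (γ : ℝ) {f b d : ℝ} (hf : 0 < f) (hb : 0 < b) (hd : |d| ≤ 1) :
    (γ + Real.sinh γ) * ((f - b) * d)
      ≤ (f - b) * (Real.log f - Real.log b) + (Real.cosh γ - 1) * (f + b) := by
  set u := (Real.log f - Real.log b) / 2 with hu
  set ρ := Real.exp ((Real.log f + Real.log b) / 2) with hρ
  have : 0 < ρ := Real.exp_pos _
  have hfρ : f = ρ * Real.exp u := by
    rw [hρ, hu, ← Real.exp_add, ← add_div, add_add_sub_cancel, add_self_div_two, Real.exp_log hf]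
  have hbρ : b = ρ * Real.exp (-u) := by
    rw [hρ, hu, ← Real.exp_add, ← neg_div, neg_sub, ← add_div, add_comm (Real.log f),
      add_add_sub_cancel, add_self_div_two, Real.exp_log hb]
  have hdiff : f - b = 2 * ρ * Real.sinh u := by rw [Real.sinh_eq, hfρ, hbρ]; ring
  have hsum : f + b = 2 * ρ * Real.cosh u := by rw [Real.cosh_eq, hfρ, hbρ]; ring
  calc (γ + Real.sinh γ) * ((f - b) * d)
      = 2 * ρ * ((γ + Real.sinh γ) * Real.sinh u * d) := by rw [hdiff]; ring
    _ ≤ 2 * ρ * |(γ + Real.sinh γ) * Real.sinh u| := by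
        gcongr
        refine (le_abs_self _).trans ?_
        rw [abs_mul]
        exact mul_le_of_le_one_right (abs_nonneg _) hd
    _ ≤ 2 * ρ * (2 * u * Real.sinh u + (Real.cosh γ - 1) * Real.cosh u) := by
        gcongr
        exact abs_add_sinh_mul_sinh_le γ u
    _ = (f - b) * (Real.log f - Real.log b) + (Real.cosh γ - 1) * (f + b) := by
        rw [hdiff, hsum, hu]; ring

theorem negMulLog_le_tangent {a y : ℝ} (ha : 0 < a) (hy : 0 ≤ y) :
    y.negMulLog ≤ a - y - y * Real.log a := by
  rcases hy.eq_or_lt with rfl | hy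
  · simpa using ha.le
  · have h := mul_le_mul_of_nonneg_left (Real.log_le_sub_one_of_pos (div_pos ha hy)) hy.le
    rw [Real.log_div ha.ne' hy.ne', mul_sub y (a / y), mul_div_cancel₀ _ hy.ne'] at h
    rw [Real.negMulLog]
    linarith

-- Jensen's inequality for `w i / W` at `u i`, `c / W` at `1` and the remaining mass at `0`
theorem sum_mul_negMulLog_le {ι : Type*} {s : Finset ι} {w u : ι → ℝ} {c W a : ℝ}
    (hw : ∀ i ∈ s, 0 ≤ w i) (hu : ∀ i ∈ s, 0 ≤ u i) (hc : 0 ≤ c) (hW : ∑ i ∈ s, w i + c ≤ W)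
    (ha : 0 ≤ a) (haW : W * a = ∑ i ∈ s, w i * u i + c) :
    ∑ i ∈ s, w i * (u i).negMulLog ≤ W * a.negMulLog := by
  have hwu : ∀ i ∈ s, 0 ≤ w i * u i := fun i hi => mul_nonneg (hw i hi) (hu i hi)
  rcases ha.eq_or_lt with rfl | ha
  · have hzero : ∑ i ∈ s, w i * u i = 0 := by linarith [Finset.sum_nonneg hwu]
    refine (Finset.sum_eq_zero fun i hi => ?_).trans_le (by simp)
    rcases mul_eq_zero.mp ((Finset.sum_eq_zero_iff_of_nonneg hwu).mp hzero i hi) with h | h <;>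
      simp [h]
  · calc ∑ i ∈ s, w i * (u i).negMulLog
        ≤ ∑ i ∈ s, (w i * a - w i * u i - w i * u i * Real.log a) :=
          Finset.sum_le_sum fun i hi =>
            (mul_le_mul_of_nonneg_left (negMulLog_le_tangent ha (hu i hi)) (hw i hi)).trans_eq
              (by ring)
      _ = (∑ i ∈ s, w i) * a - (W * a - c) - (W * a - c) * Real.log a := by
          simp only [Finset.sum_sub_distrib, ← Finset.sum_mul, haW, add_sub_cancel_right]
      _ ≤ (W - c) * a - (W * a - c) - (W * a - c) * Real.log a := by gcongr; linarith
      _ = W * a.negMulLog + c * (Real.log a - (a - 1)) := by rw [Real.negMulLog]; ring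
      _ ≤ W * a.negMulLog := add_le_of_nonpos_right <|
          mul_nonpos_of_nonneg_of_nonpos hc (sub_nonpos.mpr (Real.log_le_sub_one_of_pos ha))

-- Jensen's inequality for `y * log y` with the weights `c i / ∑ i, c i`
theorem sum_mul_log_div_sum_le {ι : Type*} {s : Finset ι} {c v : ι → ℝ}
    (hc : ∀ i ∈ s, 0 ≤ c i) (hv : ∀ i ∈ s, 0 ≤ v i) (hpos : 0 < ∑ i ∈ s, c i) :
    (∑ i ∈ s, c i * v i) * Real.log ((∑ i ∈ s, c i * v i) / ∑ i ∈ s, c i)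
      ≤ ∑ i ∈ s, c i * (v i * Real.log (v i)) := by
  have h := Real.convexOn_mul_log.map_centerMass_le hc hpos hv
  simp only [Finset.centerMass, smul_eq_mul, ← div_eq_inv_mul] at h
  rwa [div_mul_eq_mul_div, div_le_div_iff_of_pos_right hpos] at h

end Analysis

/-- A finite network with killing, the setting of the exit estimates: a vertex `x` of mass `W x`
sends the fraction `w x y / W x` of its mass to `y`, lets `c x / W x` exit, and kills the rest. -/
structure KilledNetwork (ι : Type*) [Fintype ι] where
  w : ι → ι → ℝ
  c : ι → ℝ
  W : ι → ℝ
  symm : ∀ x y, w x y = w y x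
  w_nonneg : ∀ x y, 0 ≤ w x y
  c_nonneg : ∀ x, 0 ≤ c x
  W_pos : ∀ x, 0 < W x
  sum_le : ∀ x, ∑ y, w x y + c x ≤ W x

namespace KilledNetwork

open scoped Matrix

variable {ι : Type*} [Fintype ι] (N : KilledNetwork ι) {θ : ℝ}

theorem sum_w_le (x : ι) : ∑ y, N.w x y ≤ N.W x :=
  (le_add_of_nonneg_right (N.c_nonneg x)).trans (N.sum_le x)

theorem W_lt_exp_mul (hθ : 0 < θ) (x : ι) : N.W x < Real.exp θ * N.W x :=
  lt_mul_of_one_lt_left (N.W_pos x) (Real.one_lt_exp_iff.mpr hθ)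

variable [DecidableEq ι]

/-- The Laplacian of the walk discounted at rate `θ` per step. It is scaled by `exp θ`, so that the
discount multiplies only the diagonal. -/
noncomputable def laplacian (θ : ℝ) : Matrix ι ι ℝ :=
  Matrix.diagonal (fun x => Real.exp θ * N.W x) - Matrix.of N.w

theorem laplacian_mulVec (θ : ℝ) (u : ι → ℝ) (x : ι) :
    (N.laplacian θ *ᵥ u) x = Real.exp θ * N.W x * u x - ∑ y, N.w x y * u y := by
  rw [laplacian, Matrix.sub_mulVec, Pi.sub_apply, Matrix.mulVec_diagonal]
  rfl

theorem isSymm_laplacian (θ : ℝ) : (N.laplacian θ).IsSymm :=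
  (Matrix.isSymm_diagonal _).sub (Matrix.IsSymm.ext fun x y => N.symm y x)

section Comparison

variable {N} {u u' : ι → ℝ}

theorem le_of_laplacian_le (hθ : 0 < θ)
    (h : ∀ x, u' x < u x → (N.laplacian θ *ᵥ u) x ≤ (N.laplacian θ *ᵥ u') x) (x : ι) :
    u x ≤ u' x := by
  obtain ⟨z, -, hz⟩ :=
    Finset.exists_min_image Finset.univ (fun y => u' y - u y) ⟨x, Finset.mem_univ x⟩
  refine sub_nonneg.mp (le_trans ?_ (hz x (Finset.mem_univ x)))
  by_contra! hneg
  have hlap := h z (sub_neg.mp hneg)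
  rw [laplacian_mulVec, laplacian_mulVec] at hlap
  have hmin : (∑ y, N.w z y) * (u' z - u z) ≤ ∑ y, N.w z y * (u' y - u y) := by
    rw [Finset.sum_mul]
    exact Finset.sum_le_sum fun y hy => mul_le_mul_of_nonneg_left (hz y hy) (N.w_nonneg z y)
  have hmass := mul_le_mul_of_nonpos_right (N.sum_w_le z) hneg.le
  have hstrict := mul_lt_mul_of_neg_right (N.W_lt_exp_mul hθ z) hneg
  simp only [mul_sub, Finset.sum_sub_distrib] at hmin hmass hstrict
  linarith

theorem nonneg_of_laplacian_nonneg (hθ : 0 < θ) (h : ∀ x, 0 ≤ (N.laplacian θ *ᵥ u) x) (x : ι) :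
    0 ≤ u x :=
  le_of_laplacian_le (u := 0) hθ (fun y _ => by rw [Matrix.mulVec_zero]; exact h y) x

theorem pos_of_laplacian_nonneg (hθ : 0 < θ) (h : ∀ x, 0 ≤ (N.laplacian θ *ᵥ u) x) {x y : ι}
    (hxy : N.w x y ≠ 0) (hx : 0 < u x) : 0 < u y := by
  have hu := nonneg_of_laplacian_nonneg hθ h
  have hw : 0 < N.w y x := N.symm x y ▸ (N.w_nonneg x y).lt_of_ne' hxy
  have hsingle : N.w y x * u x ≤ ∑ z, N.w y z * u z :=
    Finset.single_le_sum (f := fun z => N.w y z * u z)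
      (fun z _ => mul_nonneg (N.w_nonneg y z) (hu z)) (Finset.mem_univ x)
  have hy := h y
  rw [laplacian_mulVec] at hy
  have hlt : 0 < Real.exp θ * N.W y * u y := by linarith [mul_pos hw hx]
  exact pos_of_mul_pos_right hlt (mul_pos (Real.exp_pos θ) (N.W_pos y)).le

end Comparison

theorem isUnit_laplacian (hθ : 0 < θ) : IsUnit (N.laplacian θ) :=
  Matrix.mulVec_injective_iff_isUnit.mp fun _ _ h => funext fun x =>
    le_antisymm (le_of_laplacian_le hθ (fun y _ => (congrFun h y).le) x)
      (le_of_laplacian_le hθ (fun y _ => (congrFun h y).ge) x)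

theorem laplacian_mulVec_inv (hθ : 0 < θ) (r : ι → ℝ) :
    N.laplacian θ *ᵥ ((N.laplacian θ)⁻¹ *ᵥ r) = r := by
  rw [Matrix.mulVec_mulVec,
    Matrix.mul_nonsing_inv _ ((Matrix.isUnit_iff_isUnit_det _).mp (N.isUnit_laplacian hθ)),
    Matrix.one_mulVec]

/-- The discounted exit function `x ↦ E_x[exp (-θ T); T < ∞]`, where `T` is the time at which the
walk exits the network. -/
noncomputable def exitFunction (θ : ℝ) : ι → ℝ := (N.laplacian θ)⁻¹ *ᵥ N.c

/-- The Green density: up to the factor `W x * exp θ`, the expected discounted number of visits to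
`x` of the walk started at `o`. -/
noncomputable def green (θ : ℝ) (o : ι) : ι → ℝ := (N.laplacian θ)⁻¹ *ᵥ Pi.single o 1

/-- The flow from `o` to the exits: the expected number of crossings from `x` to `y` of the walk
started at `o`, on the event that it exits and with the discount `exp (-θ T)` of its exit time. -/
noncomputable def flow (θ : ℝ) (o x y : ι) : ℝ :=
  N.w x y * N.green θ o x * N.exitFunction θ y

theorem laplacian_mulVec_exitFunction (hθ : 0 < θ) :
    N.laplacian θ *ᵥ N.exitFunction θ = N.c :=
  N.laplacian_mulVec_inv hθ _

theorem laplacian_mulVec_green (hθ : 0 < θ) (o : ι) :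
    N.laplacian θ *ᵥ N.green θ o = Pi.single o 1 :=
  N.laplacian_mulVec_inv hθ _

theorem exp_mul_exitFunction (hθ : 0 < θ) (x : ι) :
    Real.exp θ * N.W x * N.exitFunction θ x = ∑ y, N.w x y * N.exitFunction θ y + N.c x := by
  have h := congrFun (N.laplacian_mulVec_exitFunction hθ) x
  rw [laplacian_mulVec] at h
  linarith

theorem exitFunction_nonneg (hθ : 0 < θ) (x : ι) : 0 ≤ N.exitFunction θ x :=
  nonneg_of_laplacian_nonneg hθ
    (fun y => by rw [N.laplacian_mulVec_exitFunction hθ]; exact N.c_nonneg y) x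

theorem exitFunction_le_one (hθ : 0 < θ) (x : ι) : N.exitFunction θ x ≤ 1 := by
  refine le_of_laplacian_le (N := N) (u' := 1) hθ (fun y _ => ?_) x
  rw [N.laplacian_mulVec_exitFunction hθ, laplacian_mulVec]
  simp only [Pi.one_apply, mul_one]
  linarith [N.sum_le y, N.W_lt_exp_mul hθ y]

theorem laplacian_mulVec_green_nonneg (hθ : 0 < θ) (o x : ι) :
    0 ≤ (N.laplacian θ *ᵥ N.green θ o) x := by
  rw [N.laplacian_mulVec_green hθ]
  exact (Pi.single_nonneg.mpr zero_le_one : (0 : ι → ℝ) ≤ Pi.single o 1) x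

theorem green_nonneg (hθ : 0 < θ) (o x : ι) : 0 ≤ N.green θ o x :=
  nonneg_of_laplacian_nonneg hθ (N.laplacian_mulVec_green_nonneg hθ o) x

theorem green_le (hθ : 0 < θ) (o x : ι) :
    N.green θ o x ≤ (N.W o * (Real.exp θ - 1))⁻¹ := by
  set κ := (N.W o * (Real.exp θ - 1))⁻¹ with hκ
  have hpos : 0 < N.W o * (Real.exp θ - 1) :=
    mul_pos (N.W_pos o) (sub_pos.mpr (Real.one_lt_exp_iff.mpr hθ))
  have hκ0 : 0 < κ := inv_pos.mpr hpos
  refine le_of_laplacian_le (N := N) (u' := fun _ => κ) hθ (fun y _ => ?_) x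
  rw [N.laplacian_mulVec_green hθ, laplacian_mulVec, ← Finset.sum_mul, ← sub_mul]
  rcases eq_or_ne y o with rfl | hy
  · rw [Pi.single_eq_same, ← mul_inv_cancel₀ hpos.ne', ← hκ]
    gcongr
    linarith [N.sum_w_le y]
  · rw [Pi.single_eq_of_ne hy]
    exact mul_nonneg (by linarith [N.sum_w_le y, N.W_lt_exp_mul hθ y]) hκ0.le

theorem exitFunction_mul_green_le (hθ : 0 < θ) (o x : ι) :
    N.exitFunction θ o * N.green θ o x ≤ N.green θ o o * N.exitFunction θ x := by
  refine le_of_laplacian_le (N := N) (u := N.exitFunction θ o • N.green θ o)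
    (u' := N.green θ o o • N.exitFunction θ) hθ (fun y hy => ?_) x
  have hyo : y ≠ o := by
    rintro rfl
    exact hy.ne (mul_comm _ _)
  rw [Matrix.mulVec_smul, Matrix.mulVec_smul, N.laplacian_mulVec_green hθ,
    N.laplacian_mulVec_exitFunction hθ, Pi.smul_apply, Pi.single_eq_of_ne hyo, smul_zero]
  exact mul_nonneg (N.green_nonneg hθ o o) (N.c_nonneg y)

theorem exitFunction_pos_of_green_pos (hθ : 0 < θ) {o x : ι} (ho : 0 < N.exitFunction θ o)
    (hx : 0 < N.green θ o x) : 0 < N.exitFunction θ x :=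
  pos_of_mul_pos_right ((mul_pos ho hx).trans_le (N.exitFunction_mul_green_le hθ o x))
    (N.green_nonneg hθ o o)

theorem sum_green_mul_laplacian (hθ : 0 < θ) (o : ι) (φ : ι → ℝ) :
    ∑ x, N.green θ o x * (N.laplacian θ *ᵥ φ) x = φ o := by
  change N.green θ o ⬝ᵥ (N.laplacian θ *ᵥ φ) = φ o
  rw [Matrix.dotProduct_mulVec, ← Matrix.mulVec_transpose, N.isSymm_laplacian θ,
    N.laplacian_mulVec_green hθ, single_one_dotProduct]

theorem sum_green_mul_exit (hθ : 0 < θ) (o : ι) :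
    ∑ x, N.green θ o x * N.c x = N.exitFunction θ o := by
  rw [← N.sum_green_mul_laplacian hθ o (N.exitFunction θ), N.laplacian_mulVec_exitFunction hθ]

theorem green_self_pos (hθ : 0 < θ) {o : ι} (ho : 0 < N.exitFunction θ o) :
    0 < N.green θ o o := by
  refine (N.green_nonneg hθ o o).lt_of_ne fun h0 => ho.ne' ?_
  rw [← N.sum_green_mul_exit hθ]
  refine Finset.sum_eq_zero fun x _ => ?_
  have hle := N.exitFunction_mul_green_le hθ o x
  rw [← h0, zero_mul] at hle
  rw [le_antisymm (nonpos_of_mul_nonpos_right hle ho) (N.green_nonneg hθ o x), zero_mul]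

theorem sum_c_pos (hθ : 0 < θ) {o : ι} (ho : 0 < N.exitFunction θ o) : 0 < ∑ x, N.c x := by
  rw [← N.sum_green_mul_exit hθ] at ho
  obtain ⟨x, -, hx⟩ := Finset.exists_ne_zero_of_sum_ne_zero ho.ne'
  exact Finset.sum_pos' (fun y _ => N.c_nonneg y)
    ⟨x, Finset.mem_univ x, (N.c_nonneg x).lt_of_ne' (right_ne_zero_of_mul hx)⟩

theorem sum_flow_mul_sub (hθ : 0 < θ) (o : ι) (φ : ι → ℝ) :
    ∑ x, ∑ y, N.flow θ o x y * (φ x - φ y)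
      = φ o * N.exitFunction θ o - ∑ x, φ x * (N.green θ o x * N.c x) := by
  rw [← N.sum_green_mul_laplacian hθ o fun x => φ x * N.exitFunction θ x, eq_sub_iff_add_eq,
    ← Finset.sum_add_distrib]
  refine Finset.sum_congr rfl fun x _ => ?_
  have hin : ∑ y, N.flow θ o x y * φ x
      = φ x * N.green θ o x * ∑ y, N.w x y * N.exitFunction θ y := by
    rw [Finset.mul_sum]
    exact Finset.sum_congr rfl fun y _ => by rw [flow]; ring
  have hout : ∑ y, N.flow θ o x y * φ y
      = N.green θ o x * ∑ y, N.w x y * (φ y * N.exitFunction θ y) := by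
    rw [Finset.mul_sum]
    exact Finset.sum_congr rfl fun y _ => by rw [flow]; ring
  simp only [mul_sub, Finset.sum_sub_distrib]
  rw [hin, hout, laplacian_mulVec]
  linear_combination (-(φ x * N.green θ o x)) * N.exp_mul_exitFunction hθ x

theorem sum_flow_le (hθ : 0 < θ) (o : ι) :
    ∑ x, ∑ y, N.flow θ o x y
      ≤ ∑ x, N.green θ o x * (Real.exp θ * N.W x * N.exitFunction θ x) := by
  refine Finset.sum_le_sum fun x _ => ?_
  rw [N.exp_mul_exitFunction hθ, mul_add, Finset.mul_sum]
  refine le_add_of_le_of_nonneg (Finset.sum_le_sum fun y _ => ?_)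
    (mul_nonneg (N.green_nonneg hθ o x) (N.c_nonneg x))
  rw [flow]
  exact le_of_eq (by ring)

theorem le_laplacian_negMulLog_exitFunction (hθ : 0 < θ) (x : ι) :
    θ * (Real.exp θ * N.W x * N.exitFunction θ x)
      ≤ (N.laplacian θ *ᵥ fun y => (N.exitFunction θ y).negMulLog) x := by
  have h := sum_mul_negMulLog_le (a := Real.exp θ * N.exitFunction θ x)
    (fun y _ => N.w_nonneg x y) (fun y _ => N.exitFunction_nonneg hθ y) (N.c_nonneg x)
    (N.sum_le x) (mul_nonneg (Real.exp_pos θ).le (N.exitFunction_nonneg hθ x))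
    (by rw [← N.exp_mul_exitFunction hθ]; ring)
  have hexp : (Real.exp θ).negMulLog = -(Real.exp θ * θ) := by
    rw [Real.negMulLog, Real.log_exp, neg_mul]
  rw [Real.negMulLog_mul, hexp] at h
  rw [laplacian_mulVec]
  linarith

-- With `h = E[exp (-θ T)]`, this bounds `θ E[T exp (-θ T)]` by `-h log h`.
theorem mul_sum_flow_le_negMulLog (hθ : 0 < θ) (o : ι) :
    θ * ∑ x, ∑ y, N.flow θ o x y ≤ (N.exitFunction θ o).negMulLog :=
  calc θ * ∑ x, ∑ y, N.flow θ o x y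
      ≤ θ * ∑ x, N.green θ o x * (Real.exp θ * N.W x * N.exitFunction θ x) :=
        mul_le_mul_of_nonneg_left (N.sum_flow_le hθ o) hθ.le
    _ = ∑ x, N.green θ o x * (θ * (Real.exp θ * N.W x * N.exitFunction θ x)) := by
        rw [Finset.mul_sum]
        exact Finset.sum_congr rfl fun x _ => mul_left_comm _ _ _
    _ ≤ ∑ x, N.green θ o x * (N.laplacian θ *ᵥ fun y => (N.exitFunction θ y).negMulLog) x :=
        Finset.sum_le_sum fun x _ => mul_le_mul_of_nonneg_left
          (N.le_laplacian_negMulLog_exitFunction hθ x) (N.green_nonneg hθ o x)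
    _ = (N.exitFunction θ o).negMulLog := N.sum_green_mul_laplacian hθ o _

theorem sum_flow_mul_level_sub (hθ : 0 < θ) {o : ι} {ℓ : ι → ℝ} {m : ℝ} (ho : ℓ o = 0)
    (hm : ∀ x, N.c x ≠ 0 → ℓ x = m) :
    ∑ x, ∑ y, N.flow θ o x y * (ℓ y - ℓ x) = m * N.exitFunction θ o := by
  have hexit : ∑ x, ℓ x * (N.green θ o x * N.c x) = m * N.exitFunction θ o := by
    rw [← N.sum_green_mul_exit hθ, Finset.mul_sum]
    refine Finset.sum_congr rfl fun x _ => ?_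
    by_cases hx : N.c x = 0
    · simp only [hx, mul_zero]
    · rw [hm x hx]
  have h := N.sum_flow_mul_sub hθ o fun x => -ℓ x
  simpa only [neg_sub_neg, ho, neg_zero, zero_mul, neg_mul, Finset.sum_neg_distrib, zero_sub,
    neg_neg, hexit] using h

theorem exitFunction_mul_log_le (hθ : 0 < θ) {o : ι} (ho : 0 < N.exitFunction θ o) :
    N.exitFunction θ o * Real.log (N.exitFunction θ o / ∑ x, N.c x)
      ≤ ∑ x, Real.log (N.green θ o x / N.exitFunction θ x) * (N.green θ o x * N.c x) := by
  have h := sum_mul_log_div_sum_le (fun x _ => N.c_nonneg x) (fun x _ => N.green_nonneg hθ o x)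
    (N.sum_c_pos hθ ho)
  simp only [mul_comm (N.c _) (N.green θ o _), N.sum_green_mul_exit hθ] at h
  refine h.trans (Finset.sum_le_sum fun x _ => ?_)
  rcases (N.green_nonneg hθ o x).eq_or_lt with hx | hx
  · simp only [← hx, zero_mul, mul_zero, le_refl]
  · have hlog : Real.log (N.green θ o x) ≤ Real.log (N.green θ o x / N.exitFunction θ x) :=
      Real.log_le_log hx (le_div_self hx.le (N.exitFunction_pos_of_green_pos hθ ho hx)
        (N.exitFunction_le_one hθ x))
    calc N.c x * (N.green θ o x * Real.log (N.green θ o x))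
        = Real.log (N.green θ o x) * (N.green θ o x * N.c x) := by ring
      _ ≤ _ := mul_le_mul_of_nonneg_right hlog (mul_nonneg hx.le (N.c_nonneg x))

theorem flow_entropy_le (hθ : 0 < θ) {o : ι} (ho : 0 < N.exitFunction θ o) :
    ∑ x, ∑ y, N.flow θ o x y * (Real.log (N.green θ o x / N.exitFunction θ x)
        - Real.log (N.green θ o y / N.exitFunction θ y))
      ≤ N.exitFunction θ o * (Real.log (∑ x, N.c x) - Real.log (N.W o * (Real.exp θ - 1))
        - 2 * Real.log (N.exitFunction θ o)) := by
  have hgreen : Real.log (N.green θ o o) ≤ -Real.log (N.W o * (Real.exp θ - 1)) := by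
    rw [← Real.log_inv]
    exact Real.log_le_log (N.green_self_pos hθ ho) (N.green_le hθ o o)
  have hexit := N.exitFunction_mul_log_le hθ ho
  rw [Real.log_div ho.ne' (N.sum_c_pos hθ ho).ne'] at hexit
  rw [N.sum_flow_mul_sub hθ o fun x => Real.log (N.green θ o x / N.exitFunction θ x),
    Real.log_div (N.green_self_pos hθ ho).ne' ho.ne']
  linarith [mul_le_mul_of_nonneg_right hgreen ho.le]

theorem flow_pair_le (hθ : 0 < θ) {o : ι} (ho : 0 < N.exitFunction θ o) {ℓ : ι → ℝ} {x y : ι}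
    (hℓ : N.w x y ≠ 0 → |ℓ y - ℓ x| ≤ 1) (γ : ℝ) :
    (γ + Real.sinh γ) * ((N.flow θ o x y - N.flow θ o y x) * (ℓ y - ℓ x))
      ≤ (N.flow θ o x y - N.flow θ o y x)
          * (Real.log (N.green θ o x / N.exitFunction θ x)
            - Real.log (N.green θ o y / N.exitFunction θ y))
        + (Real.cosh γ - 1) * (N.flow θ o x y + N.flow θ o y x) := by
  have hlap := N.laplacian_mulVec_green_nonneg hθ o
  by_cases hw : N.w x y = 0
  · simp [flow, hw, N.symm y x]
  rcases (N.green_nonneg hθ o x).eq_or_lt with hx | hx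
  · have hy : N.green θ o y = 0 := by
      by_contra hy
      exact hx.not_lt (pos_of_laplacian_nonneg hθ hlap (N.symm x y ▸ hw)
        ((N.green_nonneg hθ o y).lt_of_ne' hy))
    simp [flow, ← hx, hy]
  · have hy := pos_of_laplacian_nonneg hθ hlap hw hx
    have hhx := N.exitFunction_pos_of_green_pos hθ ho hx
    have hhy := N.exitFunction_pos_of_green_pos hθ ho hy
    have hwp : 0 < N.w x y := (N.w_nonneg x y).lt_of_ne' hw
    have hlog : Real.log (N.green θ o x / N.exitFunction θ x)
        - Real.log (N.green θ o y / N.exitFunction θ y)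
        = Real.log (N.flow θ o x y) - Real.log (N.flow θ o y x) := by
      rw [flow, flow, N.symm y x, Real.log_div hx.ne' hhx.ne', Real.log_div hy.ne' hhy.ne',
        Real.log_mul (by positivity) hhy.ne', Real.log_mul (by positivity) hhx.ne',
        Real.log_mul hwp.ne' hx.ne', Real.log_mul hwp.ne' hy.ne']
      ring
    rw [hlog]
    exact flux_le_entropy_add_total γ (mul_pos (mul_pos hwp hx) hhy)
      (mul_pos (mul_pos (N.symm x y ▸ hwp) hy) hhx) (hℓ hw)

theorem le_flow_entropy_add (hθ : 0 < θ) {o : ι} (ho : 0 < N.exitFunction θ o) {ℓ : ι → ℝ}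
    (hℓ : ∀ x y, N.w x y ≠ 0 → |ℓ y - ℓ x| ≤ 1) (γ : ℝ) :
    (γ + Real.sinh γ) * ∑ x, ∑ y, N.flow θ o x y * (ℓ y - ℓ x)
      ≤ ∑ x, ∑ y, N.flow θ o x y * (Real.log (N.green θ o x / N.exitFunction θ x)
          - Real.log (N.green θ o y / N.exitFunction θ y))
        + (Real.cosh γ - 1) * ∑ x, ∑ y, N.flow θ o x y := by
  let excess (x y : ι) : ℝ :=
    (γ + Real.sinh γ) * (N.flow θ o x y * (ℓ y - ℓ x))
      - N.flow θ o x y * (Real.log (N.green θ o x / N.exitFunction θ x)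
        - Real.log (N.green θ o y / N.exitFunction θ y))
      - (Real.cosh γ - 1) * N.flow θ o x y
  have hpair : ∑ x, ∑ y, (excess x y + excess y x) ≤ 0 :=
    Finset.sum_nonpos fun x _ => Finset.sum_nonpos fun y _ => by
      linarith [N.flow_pair_le hθ ho (hℓ x y) γ]
  have hswap : ∑ x, ∑ y, excess y x = ∑ x, ∑ y, excess x y := Finset.sum_comm
  have hsum : ∑ x, ∑ y, excess x y ≤ 0 := by
    simp only [Finset.sum_add_distrib, hswap] at hpair
    linarith
  simp only [excess, Finset.sum_sub_distrib, ← Finset.mul_sum] at hsum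
  linarith

theorem mul_level_le (hθ : 0 < θ) {o : ι} (ho : 0 < N.exitFunction θ o) {ℓ : ι → ℝ} {m : ℝ}
    (hℓ : ∀ x y, N.w x y ≠ 0 → |ℓ y - ℓ x| ≤ 1) (hℓo : ℓ o = 0)
    (hm : ∀ x, N.c x ≠ 0 → ℓ x = m) (γ : ℝ) :
    (γ + Real.sinh γ) * m
      ≤ Real.log (∑ x, N.c x) - Real.log (N.W o * (Real.exp θ - 1))
        + (2 + (Real.cosh γ - 1) / θ) * -Real.log (N.exitFunction θ o) := by
  set h := N.exitFunction θ o
  refine le_of_mul_le_mul_right ?_ ho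
  have htotal : ∑ x, ∑ y, N.flow θ o x y ≤ h.negMulLog / θ := by
    rw [le_div_iff₀' hθ]
    exact N.mul_sum_flow_le_negMulLog hθ o
  calc (γ + Real.sinh γ) * m * h
      = (γ + Real.sinh γ) * ∑ x, ∑ y, N.flow θ o x y * (ℓ y - ℓ x) := by
        rw [N.sum_flow_mul_level_sub hθ hℓo hm, mul_assoc]
    _ ≤ ∑ x, ∑ y, N.flow θ o x y * (Real.log (N.green θ o x / N.exitFunction θ x)
            - Real.log (N.green θ o y / N.exitFunction θ y))
          + (Real.cosh γ - 1) * ∑ x, ∑ y, N.flow θ o x y := N.le_flow_entropy_add hθ ho hℓ γ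
    _ ≤ h * (Real.log (∑ x, N.c x) - Real.log (N.W o * (Real.exp θ - 1)) - 2 * Real.log h)
          + (Real.cosh γ - 1) * (h.negMulLog / θ) :=
        add_le_add (N.flow_entropy_le hθ ho)
          (mul_le_mul_of_nonneg_left htotal (sub_nonneg.mpr (Real.one_le_cosh γ)))
    _ = _ := by rw [Real.negMulLog]; ring

end KilledNetwork

namespace WeightedGraph

section Distance

variable {V : Type*} (G : WeightedGraph V)

theorem distance_self (o : V) : G.distance o o = 0 := SimpleGraph.edist_self

variable {G} {o x y : V}

theorem distance_le_add_one (o : V) (hxy : G.w x y ≠ 0) :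
    G.distance o y ≤ G.distance o x + 1 := by
  rcases eq_or_ne x y with rfl | hne
  · exact le_self_add
  · have hadj : G.toSimpleGraph.Adj x y := ⟨hne, hxy⟩
    exact SimpleGraph.edist_triangle.trans_eq
      (congrArg _ (SimpleGraph.edist_eq_one_iff_adj.mpr hadj))

theorem exists_neighbor_distance_add_one_le (hy : G.distance o y ≠ ⊤) (hne : y ≠ o) :
    ∃ x, G.w x y ≠ 0 ∧ G.distance o x + 1 ≤ G.distance o y := by
  obtain ⟨p, hp⟩ := SimpleGraph.exists_walk_of_edist_ne_top hy
  have hnil : ¬ p.Nil := fun h => hne h.eq.symm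
  refine ⟨p.penultimate, (p.adj_penultimate hnil).2, ?_⟩
  calc G.distance o p.penultimate + 1
      ≤ (p.dropLast.length : ℕ∞) + 1 := by gcongr; exact SimpleGraph.edist_le _
    _ = G.distance o y := by
      rw [distance, ← hp, ← SimpleGraph.Walk.length_dropLast_add_one hnil, Nat.cast_add,
        Nat.cast_one]

theorem countable_support (x : V) : {y | G.w x y ≠ 0}.Countable :=
  (Summable.countable_support_ennreal (G.finite_weight x)).mono
    fun _ hy => ENNReal.coe_ne_zero.mpr hy

theorem countable_ball (G : WeightedGraph V) (o : V) (n : ℕ) :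
    {x | G.distance o x ≤ n}.Countable := by
  induction n with
  | zero =>
    refine (Set.countable_singleton o).mono fun x hx => ?_
    exact (SimpleGraph.edist_eq_zero_iff.mp (nonpos_iff_eq_zero.mp hx)).symm
  | succ n ih =>
    refine ((Set.countable_singleton o).union
      (ih.biUnion fun x _ => G.countable_support x)).mono fun y hy => ?_
    by_cases hne : y = o
    · exact Or.inl hne
    · obtain ⟨x, hxy, hx⟩ := exists_neighbor_distance_add_one_le
        (ne_top_of_le_ne_top (ENat.natCast_ne_top _) hy) hne
      refine Or.inr (Set.mem_biUnion (x := x) ?_ hxy)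
      exact (ENat.add_le_add_iff_right ENat.one_ne_top).mp (hx.trans hy)

theorem vertexWeight_pos (ho : 0 < G.vertexWeight o) (hx : G.distance o x ≠ ⊤) :
    0 < G.vertexWeight x := by
  rcases eq_or_ne x o with rfl | hne
  · exact ho
  · obtain ⟨y, hy, -⟩ := exists_neighbor_distance_add_one_le hx hne
    rw [G.symm] at hy
    exact (ENNReal.coe_pos.mpr (pos_iff_ne_zero.mpr hy)).trans_le (ENNReal.le_tsum y)

theorem abs_toNat_distance_sub_le_one (hx : G.distance o x ≠ ⊤) (hy : G.distance o y ≠ ⊤)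
    (hxy : G.w x y ≠ 0) :
    |((G.distance o y).toNat - (G.distance o x).toNat : ℝ)| ≤ 1 := by
  have hle := distance_le_add_one o hxy
  have hge := distance_le_add_one o (G.symm x y ▸ hxy)
  rw [← ENat.natCast_toNat hx, ← ENat.natCast_toNat hy] at hle hge
  have hle' : ((G.distance o y).toNat : ℝ) ≤ (G.distance o x).toNat + 1 := mod_cast hle
  have hge' : ((G.distance o x).toNat : ℝ) ≤ (G.distance o y).toNat + 1 := mod_cast hge
  exact abs_sub_le_iff.mpr ⟨by linarith, by linarith⟩

theorem distance_eq_of_le_of_lt {m : ℕ} (hx : G.distance o x ≤ m) (hy : m < G.distance o y)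
    (hxy : G.w x y ≠ 0) : G.distance o x = m :=
  hx.antisymm (Order.le_of_lt_add_one (hy.trans_le (distance_le_add_one o hxy)))

theorem sum_sum_w_le_levelWeight {m : ℕ} {B D : Finset V} (hB : ∀ x ∈ B, G.distance o x ≤ m)
    (hD : ∀ y ∈ D, m < G.distance o y) :
    ∑ x ∈ B, ∑ y ∈ D, (G.w x y : ℝ≥0∞) ≤ G.levelWeight o m := by
  classical
  let T := (B ×ˢ D).filter fun p => G.w p.1 p.2 ≠ 0
  have hT (p : T) : G.distance o p.1.1 ≤ m ∧ m < G.distance o p.1.2 ∧ G.w p.1.1 p.1.2 ≠ 0 := by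
    obtain ⟨hp, hw⟩ := Finset.mem_filter.mp p.2
    obtain ⟨hx, hy⟩ := Finset.mem_product.mp hp
    exact ⟨hB _ hx, hD _ hy, hw⟩
  let edge (p : T) : {e : Sym2 V // G.edgeDistance o e = (m : ℕ∞)} :=
    ⟨s(p.1.1, p.1.2), by
      obtain ⟨hx, hy, hw⟩ := hT p
      exact (min_eq_left (hx.trans hy.le)).trans (distance_eq_of_le_of_lt hx hy hw)⟩
  have hedge : Function.Injective edge := by
    intro p q hpq
    rcases Sym2.eq_iff.mp (congrArg Subtype.val hpq) with ⟨hx, hy⟩ | ⟨hx, -⟩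
    · exact Subtype.ext (Prod.ext hx hy)
    · exact absurd (hx ▸ (hT p).1) (hT q).2.1.not_ge
  calc ∑ x ∈ B, ∑ y ∈ D, (G.w x y : ℝ≥0∞)
      = ∑ p ∈ T, (G.w p.1 p.2 : ℝ≥0∞) := by
        rw [← Finset.sum_product', Finset.sum_filter_of_ne]
        exact fun p _ hp => ENNReal.coe_ne_zero.mp hp
    _ = ∑' p : T, G.edgeWeight (edge p) :=
        (Finset.tsum_subtype T fun p => (G.w p.1 p.2 : ℝ≥0∞)).symm
    _ ≤ G.levelWeight o m :=
        ENNReal.tsum_comp_le_tsum_of_injective hedge fun e => G.edgeWeight e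

end Distance

section Transition

variable {V : Type*} {G : WeightedGraph V} {x : V}

theorem vertexWeight_ne_top (G : WeightedGraph V) (x : V) : G.vertexWeight x ≠ ⊤ :=
  G.finite_weight x

theorem tsum_transitionProb (hx : 0 < G.vertexWeight x) : ∑' y, G.transitionProb x y = 1 := by
  simp only [transitionProb, div_eq_mul_inv]
  rw [ENNReal.tsum_mul_right]
  exact ENNReal.mul_inv_cancel hx.ne' (G.vertexWeight_ne_top x)

theorem tsum_support_transitionProb (hx : 0 < G.vertexWeight x) :
    ∑' y : {y | G.w x y ≠ 0}, G.transitionProb x y = 1 := by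
  rw [← tsum_transitionProb hx]
  refine tsum_subtype_eq_of_support_subset fun y hy hw => hy ?_
  rw [transitionProb, hw, ENNReal.coe_zero, ENNReal.zero_div]

theorem sum_transitionProb_le_one (F : Finset V) (x : V) : ∑ y ∈ F, G.transitionProb x y ≤ 1 := by
  refine (ENNReal.sum_le_tsum F).trans ?_
  simp only [transitionProb, div_eq_mul_inv]
  rw [ENNReal.tsum_mul_right]
  exact ENNReal.mul_inv_le_one _

theorem sum_transitionProb_mul_ofReal (hx : 0 < G.vertexWeight x) (F : Finset V) {u : V → ℝ}
    (hu : ∀ y, 0 ≤ u y) :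
    ∑ y ∈ F, G.transitionProb x y * ENNReal.ofReal (u y)
      = ENNReal.ofReal ((∑ y ∈ F, (G.w x y : ℝ) * u y) / (G.vertexWeight x).toReal) := by
  have hpos := ENNReal.toReal_pos hx.ne' (G.vertexWeight_ne_top x)
  rw [ENNReal.ofReal_div_of_pos hpos, ENNReal.ofReal_toReal (G.vertexWeight_ne_top x),
    ENNReal.ofReal_sum_of_nonneg fun y _ => mul_nonneg (NNReal.coe_nonneg _) (hu y),
    div_eq_mul_inv, Finset.sum_mul]
  refine Finset.sum_congr rfl fun y _ => ?_
  rw [ENNReal.ofReal_mul (NNReal.coe_nonneg _), ENNReal.ofReal_coe_nnreal, transitionProb,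
    div_eq_mul_inv, mul_right_comm]

theorem sum_w_le_toReal_vertexWeight (F : Finset V) (x : V) :
    ∑ y ∈ F, (G.w x y : ℝ) ≤ (G.vertexWeight x).toReal := by
  rw [← ENNReal.ofReal_le_iff_le_toReal (G.vertexWeight_ne_top x),
    ENNReal.ofReal_sum_of_nonneg fun y _ => NNReal.coe_nonneg _]
  simp only [ENNReal.ofReal_coe_nnreal]
  exact ENNReal.sum_le_tsum F

end Transition

/-- The network on a finite vertex set `B` whose exits are the edges to the vertices of `D`. The
walk is killed when it leaves `B ∪ D`. -/
noncomputable def killedNetwork {V : Type*} (G : WeightedGraph V) {B D : Finset V}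
    (hBD : Disjoint B D) (hB : ∀ x ∈ B, 0 < G.vertexWeight x) : KilledNetwork B where
  w x y := G.w x y
  c x := ∑ y ∈ D, (G.w x y : ℝ)
  W x := (G.vertexWeight x).toReal
  symm x y := by rw [G.symm]
  w_nonneg x y := NNReal.coe_nonneg _
  c_nonneg x := Finset.sum_nonneg fun y _ => NNReal.coe_nonneg _
  W_pos x := ENNReal.toReal_pos (hB x x.2).ne' (G.vertexWeight_ne_top x)
  sum_le x := by
    rw [Finset.sum_coe_sort B fun y => (G.w x y : ℝ), ← Finset.sum_disjUnion hBD]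
    exact sum_w_le_toReal_vertexWeight _ _

section ExtendedExit

variable {V : Type*} [DecidableEq V] {G : WeightedGraph V} {B D : Finset V} {θ : ℝ} {x : V}

/-- The discounted exit function of a network on `B`, extended by `1` to the vertices outside `B`,
where the walk has exited. -/
noncomputable def extendedExit (N : KilledNetwork B) (θ : ℝ) : V → ℝ :=
  Function.extend Subtype.val (N.exitFunction θ) 1

theorem extendedExit_of_mem (N : KilledNetwork B) (θ : ℝ) (hx : x ∈ B) :
    extendedExit N θ x = N.exitFunction θ ⟨x, hx⟩ :=
  Subtype.val_injective.extend_apply (N.exitFunction θ) 1 ⟨x, hx⟩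

theorem extendedExit_of_notMem (N : KilledNetwork B) (θ : ℝ) (hx : x ∉ B) :
    extendedExit N θ x = 1 :=
  Function.extend_apply' _ _ _ fun ⟨z, hz⟩ => hx (hz ▸ z.2)

theorem extendedExit_nonneg (N : KilledNetwork B) (hθ : 0 < θ) (x : V) :
    0 ≤ extendedExit N θ x := by
  by_cases hx : x ∈ B
  · rw [extendedExit_of_mem N θ hx]
    exact N.exitFunction_nonneg hθ _
  · rw [extendedExit_of_notMem N θ hx]
    exact zero_le_one

theorem extendedExit_le_one (N : KilledNetwork B) (hθ : 0 < θ) (x : V) :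
    extendedExit N θ x ≤ 1 := by
  by_cases hx : x ∈ B
  · rw [extendedExit_of_mem N θ hx]
    exact N.exitFunction_le_one hθ _
  · exact (extendedExit_of_notMem N θ hx).le

theorem sum_w_mul_extendedExit (hBD : Disjoint B D) (hB : ∀ x ∈ B, 0 < G.vertexWeight x)
    (hθ : 0 < θ) (hx : x ∈ B) :
    ∑ y ∈ B ∪ D, (G.w x y : ℝ) * extendedExit (G.killedNetwork hBD hB) θ y
      = Real.exp θ * (G.vertexWeight x).toReal
        * extendedExit (G.killedNetwork hBD hB) θ x := by
  set N := G.killedNetwork hBD hB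
  rw [extendedExit_of_mem N θ hx, Finset.sum_union hBD]
  refine Eq.trans ?_ (N.exp_mul_exitFunction hθ ⟨x, hx⟩).symm
  congr 1
  · rw [← Finset.sum_coe_sort B]
    exact Finset.sum_congr rfl fun y _ => congrArg _ (extendedExit_of_mem N θ y.2)
  · refine Finset.sum_congr rfl fun y hy => ?_
    rw [extendedExit_of_notMem N θ (Finset.disjoint_right.mp hBD hy), mul_one]

theorem sum_transitionProb_mul_extendedExit_le (hBD : Disjoint B D)
    (hB : ∀ x ∈ B, 0 < G.vertexWeight x) (hθ : 0 < θ) (x : V) :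
    ∑ y ∈ B ∪ D, G.transitionProb x y
        * ENNReal.ofReal (extendedExit (G.killedNetwork hBD hB) θ y)
      ≤ ENNReal.ofReal (Real.exp θ)
        * ENNReal.ofReal (extendedExit (G.killedNetwork hBD hB) θ x) := by
  set N := G.killedNetwork hBD hB
  by_cases hx : x ∈ B
  · have hpos := ENNReal.toReal_pos (hB x hx).ne' (G.vertexWeight_ne_top x)
    rw [sum_transitionProb_mul_ofReal (hB x hx) _ (extendedExit_nonneg N hθ),
      sum_w_mul_extendedExit hBD hB hθ hx, mul_right_comm, mul_div_cancel_right₀ _ hpos.ne',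
      ENNReal.ofReal_mul (Real.exp_pos θ).le]
  · calc ∑ y ∈ B ∪ D, G.transitionProb x y * ENNReal.ofReal (extendedExit N θ y)
        ≤ ∑ y ∈ B ∪ D, G.transitionProb x y := Finset.sum_le_sum fun y _ =>
          mul_le_of_le_one_right' (ENNReal.ofReal_le_one.mpr (extendedExit_le_one N hθ y))
      _ ≤ 1 := sum_transitionProb_le_one _ x
      _ ≤ ENNReal.ofReal (Real.exp θ) := ENNReal.one_le_ofReal.mpr (Real.one_le_exp hθ.le)
      _ = ENNReal.ofReal (Real.exp θ) * ENNReal.ofReal (extendedExit N θ x) := by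
        rw [extendedExit_of_notMem N θ hx, ENNReal.ofReal_one, mul_one]

end ExtendedExit

section Deviation

variable {V : Type*} {G : WeightedGraph V} {o : V} {θ : ℝ}

/-- The exponent of the exit bound: started at a vertex of weight `W`, the walk discounted at rate
`θ` per step passes level `m` with probability at most `exp (-deviationExponent W θ γ m)`, if the
edges at distance `m` have total weight at most `exp (γ * m)`. -/
noncomputable def deviationExponent (W θ γ m : ℝ) : ℝ :=
  (Real.sinh γ * m + Real.log (W * (Real.exp θ - 1))) / (2 + (Real.cosh γ - 1) / θ)

theorem log_sum_c_killedNetwork_le {m : ℕ} {γ : ℝ} {B D : Finset V} (hBD : Disjoint B D)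
    (hpos : ∀ x ∈ B, 0 < G.vertexWeight x) (hB : ∀ x ∈ B, G.distance o x ≤ m)
    (hD : ∀ y ∈ D, m < G.distance o y)
    (hm : G.levelWeight o m ≤ ENNReal.ofReal (Real.exp (γ * m)))
    (hc : 0 < ∑ x, (G.killedNetwork hBD hpos).c x) :
    Real.log (∑ x, (G.killedNetwork hBD hpos).c x) ≤ γ * m := by
  rw [Real.log_le_iff_le_exp hc, ← ENNReal.ofReal_le_ofReal_iff (Real.exp_pos _).le]
  refine le_trans (le_of_eq ?_) ((sum_sum_w_le_levelWeight hB hD).trans hm)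
  change ENNReal.ofReal (∑ x : B, ∑ y ∈ D, (G.w x y : ℝ)) = _
  rw [Finset.sum_coe_sort B fun x => ∑ y ∈ D, (G.w x y : ℝ)]
  simp only [← NNReal.coe_sum, ← ENNReal.ofNNReal_finsetSum, ENNReal.ofReal_coe_nnreal]

theorem exitFunction_killedNetwork_le [DecidableEq V] {m : ℕ} {γ : ℝ} {B D : Finset V}
    (hBD : Disjoint B D) (hpos : ∀ x ∈ B, 0 < G.vertexWeight x)
    (hB : ∀ x ∈ B, G.distance o x ≤ m) (hD : ∀ y ∈ D, m < G.distance o y) (ho : o ∈ B)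
    (hm : G.levelWeight o m ≤ ENNReal.ofReal (Real.exp (γ * m))) (hθ : 0 < θ) :
    (G.killedNetwork hBD hpos).exitFunction θ ⟨o, ho⟩
      ≤ Real.exp (-deviationExponent (G.vertexWeight o).toReal θ γ m) := by
  set N := G.killedNetwork hBD hpos
  rcases (N.exitFunction_nonneg hθ ⟨o, ho⟩).eq_or_lt with hzero | hexit
  · exact hzero ▸ (Real.exp_pos _).le
  have hfin (x : B) : G.distance o x ≠ ⊤ := ne_top_of_le_ne_top (ENat.natCast_ne_top m) (hB x x.2)
  have hlevel (x : B) (hx : N.c x ≠ 0) : ((G.distance o x).toNat : ℝ) = m := by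
    obtain ⟨y, hy, hxy⟩ := Finset.exists_ne_zero_of_sum_ne_zero hx
    rw [distance_eq_of_le_of_lt (hB x x.2) (hD y hy) (NNReal.coe_ne_zero.mp hxy),
      ENat.toNat_natCast]
  have hbound := N.mul_level_le hθ hexit (ℓ := fun x => ((G.distance o x).toNat : ℝ)) (m := m)
    (fun x y hxy => abs_toNat_distance_sub_le_one (hfin x) (hfin y) (NNReal.coe_ne_zero.mp hxy))
    (by rw [G.distance_self, ENat.toNat_zero, Nat.cast_zero]) hlevel γ
  have hc := log_sum_c_killedNetwork_le hBD hpos hB hD hm (N.sum_c_pos hθ hexit)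
  have hden : 0 < 2 + (Real.cosh γ - 1) / θ := by
    have := Real.one_le_cosh γ
    positivity
  rw [← Real.log_le_iff_le_exp hexit, le_neg, deviationExponent, div_le_iff₀' hden]
  change _ ≤ Real.log _ - Real.log ((G.vertexWeight o).toReal * (Real.exp θ - 1)) + _ at hbound
  linarith

end Deviation

namespace IsRandomWalk

variable {V : Type*} {G : WeightedGraph V} {Ω : Type*} {X : ℕ → Ω → V}

/-- The event that the trajectory lies in the sets `C 0, …, C n` up to time `n`. -/
def confined (X : ℕ → Ω → V) (C : ℕ → Set V) (n : ℕ) : Set Ω := {ω | ∀ j ≤ n, X j ω ∈ C j}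

variable [MeasurableSpace Ω] {P : Measure Ω} {o : V} {C : ℕ → Set V}

section Markov

theorem measurableSet_mem (hX : G.IsRandomWalk P o X) (k : ℕ) {Z : Set V} (hZ : Z.Countable) :
    MeasurableSet {ω | X k ω ∈ Z} := by
  rw [show {ω | X k ω ∈ Z} = ⋃ x ∈ Z, {ω | X k ω = x} by ext ω; simp]
  exact MeasurableSet.biUnion hZ fun x _ => hX.measurableSet_eq k x

theorem measurableSet_confined (hX : G.IsRandomWalk P o X) (hC : ∀ j, (C j).Countable) (n : ℕ) :
    MeasurableSet (confined X C n) := by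
  rw [show confined X C n = ⋂ j, ⋂ _ : j ≤ n, {ω | X j ω ∈ C j} by ext ω; simp [confined]]
  exact MeasurableSet.iInter fun j => MeasurableSet.iInter fun _ => hX.measurableSet_mem j (hC j)

theorem measure_inter_mem (hX : G.IsRandomWalk P o X) (A : Set Ω) (k : ℕ) {Z : Set V}
    (hZ : Z.Countable) : P (A ∩ {ω | X k ω ∈ Z}) = ∑' x : Z, P (A ∩ {ω | X k ω = x}) := by
  have h := tsum_measure_preimage_singleton (μ := P.restrict A) hZ (f := X k)
    fun x _ => hX.measurableSet_eq k x
  rw [Set.inter_comm, ← Measure.restrict_apply (hX.measurableSet_mem k hZ)]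
  refine h.symm.trans (tsum_congr fun x => ?_)
  rw [Set.inter_comm, ← Measure.restrict_apply (hX.measurableSet_eq k x)]
  rfl

theorem measure_path_step (hX : G.IsRandomWalk P o X) (n : ℕ) (f : Fin (n + 1) → V) (y : V) :
    P ({ω | ∀ i : Fin (n + 1), X i ω = f i} ∩ {ω | X (n + 1) ω = y})
      = P {ω | ∀ i : Fin (n + 1), X i ω = f i} * G.transitionProb (f (Fin.last n)) y := by
  have hpath (ω : Ω) : (∀ i ≤ n, X i ω = f (Fin.ofNat (n + 1) i))
      ↔ ∀ i : Fin (n + 1), X i ω = f i := by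
    rw [Fin.forall_iff]
    refine forall_congr' fun i => ⟨fun h hi => ?_, fun h hi => ?_⟩
    · rw [h (Nat.lt_succ_iff.mp hi)]
      congr 1
      exact Fin.ext (Nat.mod_eq_of_lt hi)
    · rw [h (Nat.lt_succ_of_le hi)]
      congr 1
      exact Fin.ext (Nat.mod_eq_of_lt (Nat.lt_succ_of_le hi)).symm
  have h := hX.step n (fun i => f (Fin.ofNat (n + 1) i)) y
  simp only [hpath, show Fin.ofNat (n + 1) n = Fin.last n from
    Fin.ext (Nat.mod_eq_of_lt n.lt_succ_self)] at h
  exact h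

theorem measure_confined_step (hX : G.IsRandomWalk P o X) (hC : ∀ j, (C j).Countable) (n : ℕ)
    (x y : V) :
    P (confined X C n ∩ {ω | X n ω = x} ∩ {ω | X (n + 1) ω = y})
      = P (confined X C n ∩ {ω | X n ω = x}) * G.transitionProb x y := by
  let path (f : Fin (n + 1) → V) : Set Ω := {ω | ∀ i : Fin (n + 1), X i ω = f i}
  let S : Set (Fin (n + 1) → V) := {f | (∀ i : Fin (n + 1), f i ∈ C i) ∧ f (Fin.last n) = x}
  have hS : S.Countable :=
    (Set.countable_univ_pi fun i : Fin (n + 1) => hC i).mono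
      (show S ⊆ Set.univ.pi _ from fun f hf i _ => hf.1 i)
  have hpath (f : Fin (n + 1) → V) : MeasurableSet (path f) := by
    rw [show path f = ⋂ i : Fin (n + 1), {ω | X i ω = f i} by ext ω; simp [path]]
    exact MeasurableSet.iInter fun i => hX.measurableSet_eq i (f i)
  have hdisj : S.PairwiseDisjoint path := fun f _ g _ hfg =>
    Set.disjoint_left.mpr fun ω hf hg => hfg (funext fun i => (hf i).symm.trans (hg i))
  have hunion : confined X C n ∩ {ω | X n ω = x} = ⋃ f ∈ S, path f := by
    ext ω
    simp only [Set.mem_iUnion, exists_prop]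
    constructor
    · rintro ⟨hω, hx⟩
      exact ⟨fun i => X i ω, ⟨fun i => hω i i.is_le, hx⟩, fun i => rfl⟩
    · rintro ⟨f, ⟨hfC, hfx⟩, hf⟩
      refine ⟨fun j hj => ?_, (hf (Fin.last n)).trans hfx⟩
      let i : Fin (n + 1) := ⟨j, Nat.lt_succ_of_le hj⟩
      exact (hf i).symm ▸ hfC i
  rw [hunion, Set.iUnion₂_inter, measure_biUnion hS hdisj fun f _ => hpath f,
    measure_biUnion hS (hdisj.mono fun f => Set.inter_subset_left)
      fun f _ => (hpath f).inter (hX.measurableSet_eq _ _), ← ENNReal.tsum_mul_right]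
  exact tsum_congr fun f => by rw [hX.measure_path_step, f.2.2]

theorem measure_confined_le_succ (hX : G.IsRandomWalk P o X) (hC : ∀ j, (C j).Countable) {n : ℕ}
    (hpos : ∀ x ∈ C n, 0 < G.vertexWeight x)
    (hstep : ∀ x ∈ C n, ∀ y, G.w x y ≠ 0 → y ∈ C (n + 1)) :
    P (confined X C n) ≤ P (confined X C (n + 1)) :=
  calc P (confined X C n)
      = P (confined X C n ∩ {ω | X n ω ∈ C n}) := by
        have hlast : confined X C n ⊆ {ω | X n ω ∈ C n} := fun ω hω => hω n le_rfl
        rw [Set.inter_eq_left.mpr hlast]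
    _ = ∑' x : C n, P (confined X C n ∩ {ω | X n ω = x}) := hX.measure_inter_mem _ n (hC n)
    _ = ∑' x : C n, P (confined X C n ∩ {ω | X n ω = x}
          ∩ {ω | X (n + 1) ω ∈ {y | G.w x y ≠ 0}}) := tsum_congr fun x => by
        rw [hX.measure_inter_mem _ _ (countable_support (G := G) x)]
        simp only [hX.measure_confined_step hC]
        rw [ENNReal.tsum_mul_left, tsum_support_transitionProb (hpos x x.2), mul_one]
    _ ≤ ∑' x : C n, P (confined X C (n + 1) ∩ {ω | X n ω = x}) := by
        refine ENNReal.tsum_le_tsum fun x => measure_mono ?_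
        rintro ω ⟨⟨hω, hx⟩, hy⟩
        refine ⟨fun j hj => ?_, hx⟩
        rcases hj.eq_or_lt with rfl | hj
        · exact hstep x x.2 _ hy
        · exact hω j (Nat.lt_succ_iff.mp hj)
    _ = P (confined X C (n + 1) ∩ {ω | X n ω ∈ C n}) := (hX.measure_inter_mem _ n (hC n)).symm
    _ ≤ P (confined X C (n + 1)) := measure_mono Set.inter_subset_left

theorem measure_confined_ball [IsProbabilityMeasure P] (hX : G.IsRandomWalk P o X)
    (ho : 0 < G.vertexWeight o) (n : ℕ) :
    P (confined X (fun j => {x | G.distance o x ≤ j}) n) = 1 := by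
  induction n with
  | zero =>
    refine le_antisymm prob_le_one (hX.start.symm.trans_le (measure_mono fun ω hω j hj => ?_))
    obtain rfl := Nat.le_zero.mp hj
    exact (congrArg (G.distance o) hω).trans_le (G.distance_self o).le
  | succ n ih =>
    refine le_antisymm prob_le_one (ih.symm.trans_le
      (hX.measure_confined_le_succ (G.countable_ball o) (fun x hx => ?_) fun x hx y hxy => ?_))
    · exact vertexWeight_pos ho (ne_top_of_le_ne_top (ENat.natCast_ne_top n) hx)
    · rw [Set.mem_ofPred_eq] at hx ⊢
      rw [Nat.cast_succ]
      exact (distance_le_add_one o hxy).trans (add_le_add_left hx 1)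

theorem ae_distance_le [IsProbabilityMeasure P] (hX : G.IsRandomWalk P o X)
    (ho : 0 < G.vertexWeight o) : ∀ᵐ ω ∂P, ∀ k, G.distance o (X k ω) ≤ k := by
  refine ae_all_iff.mpr fun k => ?_
  have hball := (mem_ae_iff_prob_eq_one (hX.measurableSet_confined (G.countable_ball o) k)).mpr
    (hX.measure_confined_ball ho k)
  filter_upwards [hball] with ω hω using hω k le_rfl

end Markov

section Exit

theorem sum_measure_start_mul_le [IsProbabilityMeasure P] (hX : G.IsRandomWalk P o X)
    (F : Finset V) (H : V → ℝ≥0∞) : ∑ x ∈ F, P {ω | X 0 ω = x} * H x ≤ H o := by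
  classical
  calc ∑ x ∈ F, P {ω | X 0 ω = x} * H x
      ≤ ∑ x ∈ F, if x = o then H x else 0 := Finset.sum_le_sum fun x _ => by
        split_ifs with hx
        · exact mul_le_of_le_one_left' prob_le_one
        · refine (mul_eq_zero_of_left (measure_mono_null ?_
            ((prob_compl_eq_zero_iff (hX.measurableSet_eq 0 o)).mpr hX.start)) _).le
          exact fun ω hω ho => hx (hω.symm.trans ho)
    _ ≤ H o := by
        rw [Finset.sum_ite_eq']
        split_ifs
        exacts [le_rfl, zero_le]

theorem sum_measure_confined_mul_le [IsProbabilityMeasure P] (hX : G.IsRandomWalk P o X)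
    {F : Finset V} {H : V → ℝ≥0∞} {E : ℝ≥0∞}
    (hH : ∀ x ∈ F, ∑ y ∈ F, G.transitionProb x y * H y ≤ E * H x) (n : ℕ) :
    ∑ x ∈ F, P (confined X (fun _ => F) n ∩ {ω | X n ω = x}) * H x ≤ E ^ n * H o := by
  induction n with
  | zero =>
    rw [pow_zero, one_mul]
    refine le_trans (Finset.sum_le_sum fun x _ => ?_) (hX.sum_measure_start_mul_le F H)
    exact mul_le_mul_left (measure_mono Set.inter_subset_right) _
  | succ n ih =>
    have hF : ∀ _ : ℕ, (F : Set V).Countable := fun _ => F.countable_toSet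
    have hsucc (y : V) : P (confined X (fun _ => F) (n + 1) ∩ {ω | X (n + 1) ω = y})
        ≤ ∑ x ∈ F, P (confined X (fun _ => F) n ∩ {ω | X n ω = x}) * G.transitionProb x y := by
      simp only [← hX.measure_confined_step hF]
      refine (measure_mono fun ω hω => ?_).trans (measure_biUnion_finset_le F _)
      exact Set.mem_biUnion (hω.1 n n.le_succ)
        ⟨⟨fun j hj => hω.1 j (hj.trans n.le_succ), rfl⟩, hω.2⟩
    calc ∑ y ∈ F, P (confined X (fun _ => F) (n + 1) ∩ {ω | X (n + 1) ω = y}) * H y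
        ≤ ∑ y ∈ F, (∑ x ∈ F, P (confined X (fun _ => F) n ∩ {ω | X n ω = x})
            * G.transitionProb x y) * H y :=
          Finset.sum_le_sum fun y _ => mul_le_mul_left (hsucc y) _
      _ = ∑ x ∈ F, P (confined X (fun _ => F) n ∩ {ω | X n ω = x})
            * ∑ y ∈ F, G.transitionProb x y * H y := by
          simp only [Finset.sum_mul, Finset.mul_sum, mul_assoc]
          exact Finset.sum_comm
      _ ≤ ∑ x ∈ F, P (confined X (fun _ => F) n ∩ {ω | X n ω = x}) * (E * H x) :=
          Finset.sum_le_sum fun x hx => mul_le_mul_right (hH x hx) _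
      _ = E * ∑ x ∈ F, P (confined X (fun _ => F) n ∩ {ω | X n ω = x}) * H x := by
          simp only [Finset.mul_sum, mul_left_comm]
      _ ≤ E * (E ^ n * H o) := mul_le_mul_right ih _
      _ = E ^ (n + 1) * H o := by rw [← mul_assoc, pow_succ']

theorem measure_confined_inter_mem_le [IsProbabilityMeasure P] (hX : G.IsRandomWalk P o X)
    {F Z : Finset V} (hZF : Z ⊆ F) {H : V → ℝ≥0∞} {E : ℝ≥0∞}
    (hH : ∀ x ∈ F, ∑ y ∈ F, G.transitionProb x y * H y ≤ E * H x) (hHZ : ∀ x ∈ Z, 1 ≤ H x)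
    (n : ℕ) : P (confined X (fun _ => F) n ∩ {ω | X n ω ∈ Z}) ≤ E ^ n * H o :=
  calc P (confined X (fun _ => F) n ∩ {ω | X n ω ∈ Z})
      = ∑ x ∈ Z, P (confined X (fun _ => F) n ∩ {ω | X n ω = x}) :=
        (hX.measure_inter_mem _ n Z.countable_toSet).trans
          (Z.tsum_subtype fun x => P (confined X (fun _ => F) n ∩ {ω | X n ω = x}))
    _ ≤ ∑ x ∈ Z, P (confined X (fun _ => F) n ∩ {ω | X n ω = x}) * H x :=
        Finset.sum_le_sum fun x hx => le_mul_of_one_le_right' (hHZ x hx)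
    _ ≤ ∑ x ∈ F, P (confined X (fun _ => F) n ∩ {ω | X n ω = x}) * H x :=
        Finset.sum_le_sum_of_subset hZF
    _ ≤ E ^ n * H o := hX.sum_measure_confined_mul_le hH n

theorem measure_exit_le [IsProbabilityMeasure P] [DecidableEq V] (hX : G.IsRandomWalk P o X)
    {B D : Finset V} (hBD : Disjoint B D) (hB : ∀ x ∈ B, 0 < G.vertexWeight x) (ho : o ∈ B)
    {θ : ℝ} (hθ : 0 < θ) (k : ℕ) :
    P (confined X (fun _ => ↑(B ∪ D)) k ∩ {ω | X k ω ∈ D})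
      ≤ ENNReal.ofReal
        (Real.exp (θ * k) * (G.killedNetwork hBD hB).exitFunction θ ⟨o, ho⟩) := by
  have h := hX.measure_confined_inter_mem_le (Z := D) Finset.subset_union_right
    (fun x _ => sum_transitionProb_mul_extendedExit_le hBD hB hθ x) (fun x hx => by
      rw [extendedExit_of_notMem _ θ (Finset.disjoint_right.mp hBD hx), ENNReal.ofReal_one]) k
  rwa [extendedExit_of_mem _ θ ho, ← ENNReal.ofReal_pow (Real.exp_pos θ).le,
    ← ENNReal.ofReal_mul (pow_nonneg (Real.exp_pos θ).le k), ← Real.exp_nat_mul,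
    mul_comm (k : ℝ)] at h

theorem measure_le_of_forall_finset {Z : Set V} (hZ : Z.Countable) {k : ℕ}
    (hmem : ∀ᵐ ω ∂P, ω ∈ confined X (fun _ => Z) k) {A : Set Ω} {b : ℝ≥0∞}
    (hA : ∀ F : Finset V, P (confined X (fun _ => F) k ∩ A) ≤ b) : P A ≤ b := by
  classical
  have := hZ.to_subtype
  let vertices (s : Finset Z) : Finset V := s.map (Function.Embedding.subtype _)
  let event (s : Finset Z) : Set Ω := confined X (fun _ => vertices s) k ∩ A
  have hmono : Monotone event := fun s t hst =>
    Set.inter_subset_inter_left _ fun ω hω j hj => Finset.map_subset_map.mpr hst (hω j hj)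
  have hcover : P A ≤ P (⋃ s, event s) := by
    refine measure_mono_ae ?_
    filter_upwards [hmem] with ω hω hωA
    let visited : Finset Z := Finset.univ.image fun j : Fin (k + 1) => ⟨X j ω, hω j j.is_le⟩
    refine Set.mem_iUnion.mpr ⟨visited, fun j hj => ?_, hωA⟩
    exact Finset.mem_map.mpr ⟨⟨X j ω, hω j hj⟩,
      Finset.mem_image_of_mem _ (Finset.mem_univ (⟨j, Nat.lt_succ_of_le hj⟩ : Fin (k + 1))), rfl⟩
  refine hcover.trans ?_
  rw [hmono.directed_le.measure_iUnion]
  exact iSup_le fun s => hA (vertices s)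

theorem measure_lt_distance_le [IsProbabilityMeasure P] (hX : G.IsRandomWalk P o X)
    (ho : 0 < G.vertexWeight o) {m : ℕ} {γ θ : ℝ} (hθ : 0 < θ)
    (hm : G.levelWeight o m ≤ ENNReal.ofReal (Real.exp (γ * m))) (k : ℕ) :
    P {ω | m < G.distance o (X k ω)}
      ≤ ENNReal.ofReal
        (Real.exp (θ * k - deviationExponent (G.vertexWeight o).toReal θ γ m)) := by
  classical
  have hball : ∀ᵐ ω ∂P, ω ∈ confined X (fun _ => {x | G.distance o x ≤ k}) k := by
    filter_upwards [hX.ae_distance_le ho] with ω hω j hj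
    exact (hω j).trans (Nat.cast_le.mpr hj)
  refine measure_le_of_forall_finset (G.countable_ball o k) hball fun F => ?_
  let B := (insert o F).filter fun x => G.distance o x ≤ m
  let D := F.filter fun x => m < G.distance o x
  have hBD : Disjoint B D := Finset.disjoint_left.mpr fun x hx hx' =>
    (Finset.mem_filter.mp hx').2.not_ge (Finset.mem_filter.mp hx).2
  have hB : ∀ x ∈ B, G.distance o x ≤ m := fun x hx => (Finset.mem_filter.mp hx).2
  have hD : ∀ y ∈ D, m < G.distance o y := fun y hy => (Finset.mem_filter.mp hy).2
  have hpos : ∀ x ∈ B, 0 < G.vertexWeight x := fun x hx =>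
    vertexWeight_pos ho (ne_top_of_le_ne_top (ENat.natCast_ne_top m) (hB x hx))
  have hoB : o ∈ B := Finset.mem_filter.mpr
    ⟨Finset.mem_insert_self o F, (G.distance_self o).trans_le zero_le⟩
  have hsub : confined X (fun _ => F) k ∩ {ω | m < G.distance o (X k ω)}
      ⊆ confined X (fun _ => ↑(B ∪ D)) k ∩ {ω | X k ω ∈ D} := by
    rintro ω ⟨hω, hlt⟩
    refine ⟨fun j hj => ?_, Finset.mem_filter.mpr ⟨hω k le_rfl, hlt⟩⟩
    rcases le_or_gt (G.distance o (X j ω)) m with hle | hgt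
    · exact Finset.mem_union_left _
        (Finset.mem_filter.mpr ⟨Finset.mem_insert_of_mem (hω j hj), hle⟩)
    · exact Finset.mem_union_right _ (Finset.mem_filter.mpr ⟨hω j hj, hgt⟩)
  refine (measure_mono hsub).trans ((hX.measure_exit_le hBD hpos hoB hθ k).trans
    (ENNReal.ofReal_le_ofReal ?_))
  rw [sub_eq_add_neg, Real.exp_add]
  exact mul_le_mul_of_nonneg_left (exitFunction_killedNetwork_le hBD hpos hB hD hoB hm hθ)
    (Real.exp_pos _).le

end Exit

end IsRandomWalk

section Rate

theorem eventually_levelWeight_le {V : Type*} {G : WeightedGraph V} {o : V} {q : ℝ} (hq : 0 < q)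
    (hlt : G.upperGrowth o < ENNReal.ofReal q) :
    ∀ᶠ n : ℕ in atTop, G.levelWeight o n ≤ ENNReal.ofReal (Real.exp (Real.log q * n)) := by
  filter_upwards [eventually_lt_of_limsup_lt hlt, eventually_gt_atTop 0] with n hn hn0
  have hpow := ENNReal.rpow_le_rpow hn.le (Nat.cast_nonneg n : (0 : ℝ) ≤ n)
  rw [← ENNReal.rpow_mul, one_div_mul_cancel (Nat.cast_ne_zero.mpr hn0.ne'), ENNReal.rpow_one,
    ENNReal.rpow_natCast, ← ENNReal.ofReal_pow hq.le] at hpow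
  rwa [mul_comm, Real.exp_nat_mul, Real.exp_log hq]

theorem cosh_log_sub_one_lt_mul_sinh_log {q a : ℝ} (hq : 1 < q) (haq : q - 1 < a * (q + 1)) :
    Real.cosh (Real.log q) - 1 < a * Real.sinh (Real.log q) := by
  have hq0 : 0 < q := one_pos.trans hq
  have hgap : a * Real.sinh (Real.log q) - (Real.cosh (Real.log q) - 1)
      = (q - 1) / (2 * q) * (a * (q + 1) - (q - 1)) := by
    rw [Real.sinh_log hq0, Real.cosh_log hq0]
    field_simp
    ring
  rw [← sub_pos, hgap]
  exact mul_pos (div_pos (sub_pos.mpr hq) (by positivity)) (sub_pos.mpr haq)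

theorem exists_linear_le_deviationExponent_sub {γ a : ℝ} (W : ℝ) (hγ : 0 ≤ γ)
    (haγ : Real.cosh γ - 1 < a * Real.sinh γ) :
    ∃ θ > 0, ∃ β > 0, ∃ c, ∀ k m : ℝ, a * k - 1 ≤ m →
      β * k + c ≤ deviationExponent W θ γ m - θ * k := by
  -- As `θ → 0`, `θ * D → cosh γ - 1`, so that `a * sinh γ / D` exceeds `θ` for small `θ`.
  set θ := (a * Real.sinh γ - (Real.cosh γ - 1)) / 4 with hθ
  set D := 2 + (Real.cosh γ - 1) / θ with hD
  have hcosh := Real.one_le_cosh γ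
  have hθ0 : 0 < θ := div_pos (sub_pos.mpr haγ) four_pos
  have hD0 : 0 < D := by positivity
  have hDθ : D * θ = 2 * θ + (Real.cosh γ - 1) := by
    rw [hD, add_mul, div_mul_cancel₀ _ hθ0.ne']
  refine ⟨θ, hθ0, a * Real.sinh γ / D - θ, ?_,
    (Real.log (W * (Real.exp θ - 1)) - Real.sinh γ) / D, fun k m hm => ?_⟩
  · rw [gt_iff_lt, sub_pos, lt_div_iff₀ hD0]
    linarith
  · have hsinh : Real.sinh γ * (a * k - 1) ≤ Real.sinh γ * m :=
      mul_le_mul_of_nonneg_left hm (Real.sinh_nonneg_iff.mpr hγ)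
    calc (a * Real.sinh γ / D - θ) * k + (Real.log (W * (Real.exp θ - 1)) - Real.sinh γ) / D
        = (Real.sinh γ * (a * k - 1) + Real.log (W * (Real.exp θ - 1))) / D - θ * k := by ring
      _ ≤ deviationExponent W θ γ m - θ * k := by
        rw [deviationExponent]
        gcongr

theorem ae_eventually_notMem_of_eventually_le {Ω : Type*} [MeasurableSpace Ω] {P : Measure Ω}
    {A : ℕ → Set Ω} {f : ℕ → ℝ} (hf : Summable f)
    (hA : ∀ᶠ n in atTop, P (A n) ≤ ENNReal.ofReal (f n)) : ∀ᵐ ω ∂P, ∀ᶠ n in atTop, ω ∉ A n := by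
  obtain ⟨N, hN⟩ := eventually_atTop.mp hA
  have hsum : ∑' n, P (A (n + N)) ≠ ⊤ :=
    ne_top_of_le_ne_top ((summable_nat_add_iff N).mpr hf).tsum_ofReal_ne_top
      (ENNReal.tsum_le_tsum fun n => hN (n + N) (Nat.le_add_left N n))
  filter_upwards [ae_eventually_notMem hsum] with ω hω
  rw [← map_add_atTop_eq_nat N]
  exact hω

end Rate

section Speed

/-- The upper speed `limsup |x_k| / k` of a trajectory, where `|v|` is the distance from `o`. -/
noncomputable def upperSpeed {V : Type*} (G : WeightedGraph V) (o : V) (x : ℕ → V) : ℝ≥0∞ :=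
  limsup (fun k : ℕ => ((G.distance o (x k) : ℕ∞) : ℝ≥0∞) / (k : ℝ≥0∞)) atTop

variable {V : Type*} {G : WeightedGraph V} {o : V}

theorem upperSpeed_le_of_eventually {x : ℕ → V} {a : ℝ} (ha : 0 ≤ a)
    (hx : ∀ᶠ k : ℕ in atTop, G.distance o (x k) ≤ ⌊a * k⌋₊) :
    G.upperSpeed o x ≤ ENNReal.ofReal a := by
  refine limsup_le_of_le (by isBoundedDefault) (hx.mono fun k hk => ENNReal.div_le_of_le_mul ?_)
  calc ((G.distance o (x k) : ℕ∞) : ℝ≥0∞)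
      ≤ (⌊a * k⌋₊ : ℝ≥0∞) := by
        rw [← ENat.toENNReal_coe]
        exact ENat.toENNReal_le.mpr hk
    _ = ENNReal.ofReal (⌊a * k⌋₊ : ℝ) := (ENNReal.ofReal_natCast _).symm
    _ ≤ ENNReal.ofReal (a * k) := ENNReal.ofReal_le_ofReal (Nat.floor_le (by positivity))
    _ = ENNReal.ofReal a * k := by rw [ENNReal.ofReal_mul ha, ENNReal.ofReal_natCast]

namespace IsRandomWalk

variable {Ω : Type*} [MeasurableSpace Ω] {P : Measure Ω} [IsProbabilityMeasure P] {X : ℕ → Ω → V}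

theorem ae_upperSpeed_le_one (hX : G.IsRandomWalk P o X) (ho : 0 < G.vertexWeight o) :
    ∀ᵐ ω ∂P, G.upperSpeed o (fun k => X k ω) ≤ 1 := by
  filter_upwards [hX.ae_distance_le ho] with ω hω
  rw [← ENNReal.ofReal_one]
  refine upperSpeed_le_of_eventually zero_le_one (Eventually.of_forall fun k => ?_)
  rw [one_mul, Nat.floor_natCast]
  exact hω k

theorem exists_summable_measure_lt_distance_le (hX : G.IsRandomWalk P o X)
    (ho : 0 < G.vertexWeight o) {q a : ℝ} (hq : 1 < q) (ha : 0 < a)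
    (hlt : G.upperGrowth o < ENNReal.ofReal q) (haq : q - 1 < a * (q + 1)) :
    ∃ f : ℕ → ℝ, Summable f ∧
      ∀ᶠ k : ℕ in atTop, P {ω | ⌊a * k⌋₊ < G.distance o (X k ω)} ≤ ENNReal.ofReal (f k) := by
  obtain ⟨θ, hθ, β, hβ, c, hrate⟩ := exists_linear_le_deviationExponent_sub
    (G.vertexWeight o).toReal (Real.log_nonneg hq.le) (cosh_log_sub_one_lt_mul_sinh_log hq haq)
  refine ⟨fun k => Real.exp (-c) * Real.exp (-β) ^ k, ?_, ?_⟩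
  · exact (summable_geometric_of_lt_one (Real.exp_pos _).le
      (Real.exp_lt_one_iff.mpr (neg_lt_zero.mpr hβ))).mul_left _
  have hfloor : Tendsto (fun k : ℕ => ⌊a * k⌋₊) atTop atTop :=
    tendsto_nat_floor_atTop.comp (tendsto_natCast_atTop_atTop.const_mul_atTop ha)
  filter_upwards [hfloor.eventually (eventually_levelWeight_le (one_pos.trans hq) hlt)] with k hk
  refine (hX.measure_lt_distance_le ho hθ hk k).trans (ENNReal.ofReal_le_ofReal ?_)
  rw [← Real.exp_nat_mul, ← Real.exp_add]
  have hk' := hrate k ⌊a * k⌋₊ (Nat.sub_one_lt_floor (a * k)).le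
  exact Real.exp_le_exp.mpr (by linarith)

theorem ae_upperSpeed_le_of_lt (hX : G.IsRandomWalk P o X) (ho : 0 < G.vertexWeight o) {g a : ℝ}
    (hg : 1 ≤ g) (hgrowth : G.upperGrowth o ≤ ENNReal.ofReal g) (hga : (g - 1) / (g + 1) < a) :
    ∀ᵐ ω ∂P, G.upperSpeed o (fun k => X k ω) ≤ ENNReal.ofReal a := by
  have ha : 0 < a := (div_nonneg (by linarith) (by linarith)).trans_lt hga
  rw [div_lt_iff₀ (by linarith)] at hga
  obtain ⟨q, hgq, haq⟩ : ∃ q > g, q - 1 < a * (q + 1) := by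
    refine ⟨g + (a * (g + 1) - (g - 1)) / 2, by linarith, ?_⟩
    have := mul_pos ha (sub_pos.mpr hga)
    linarith
  have hq : 1 < q := hg.trans_lt hgq
  have hlt : G.upperGrowth o < ENNReal.ofReal q :=
    hgrowth.trans_lt ((ENNReal.ofReal_lt_ofReal_iff (by linarith)).mpr hgq)
  obtain ⟨f, hf, hPf⟩ := hX.exists_summable_measure_lt_distance_le ho hq ha hlt haq
  filter_upwards [ae_eventually_notMem_of_eventually_le hf hPf] with ω hω
  exact upperSpeed_le_of_eventually ha.le (hω.mono fun k hk => not_lt.mp hk)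

theorem ae_upperSpeed_le (hX : G.IsRandomWalk P o X) (ho : 0 < G.vertexWeight o) {g : ℝ}
    (hg : 1 ≤ g) (hgrowth : G.upperGrowth o ≤ ENNReal.ofReal g) :
    ∀ᵐ ω ∂P, G.upperSpeed o (fun k => X k ω) ≤ ENNReal.ofReal ((g - 1) / (g + 1)) := by
  obtain ⟨a, -, hgt, hlim⟩ := exists_seq_strictAnti_tendsto ((g - 1) / (g + 1))
  filter_upwards [ae_all_iff.mpr fun j => hX.ae_upperSpeed_le_of_lt ho hg hgrowth (hgt j)] with ω hω
  exact ge_of_tendsto' (ENNReal.tendsto_ofReal hlim) hω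

end IsRandomWalk

end Speed

end WeightedGraph

theorem speedBound_of_ne_top {g : ℝ≥0∞} (hg : g ≠ ⊤) :
    speedBound g = ENNReal.ofReal ((g.toReal - 1) / (g.toReal + 1)) := by
  have hpos : 0 < g.toReal + 1 := by positivity
  rw [speedBound, if_neg hg, ENNReal.ofReal_div_of_pos hpos, ENNReal.ofReal_sub _ zero_le_one,
    ENNReal.ofReal_add ENNReal.toReal_nonneg zero_le_one, ENNReal.ofReal_toReal hg,
    ENNReal.ofReal_one]

theorem corollary4 {V : Type*} [Infinite V] (G : WeightedGraph V) (o : V)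
    (ho : 0 < G.vertexWeight o)
    {Ω : Type*} [MeasurableSpace Ω] (P : Measure Ω) [IsProbabilityMeasure P]
    (X : ℕ → Ω → V) (hX : G.IsRandomWalk P o X)
    (g₀ g : ℝ≥0∞) (hg₀ : g₀ = G.upperGrowth o) (hg : g = max g₀ 1) :
    ∀ᵐ ω ∂P,
      limsup (fun k : ℕ => ((G.distance o (X k ω) : ℕ∞) : ℝ≥0∞) / (k : ℝ≥0∞)) atTop
        ≤ speedBound g := by
  by_cases htop : g = ⊤
  · rw [speedBound, if_pos htop]
    exact hX.ae_upperSpeed_le_one ho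
  · have hone : 1 ≤ g.toReal :=
      ENNReal.toReal_one ▸ ENNReal.toReal_mono htop (hg ▸ le_max_right g₀ 1)
    have hgrowth : G.upperGrowth o ≤ ENNReal.ofReal g.toReal := by
      rw [ENNReal.ofReal_toReal htop, hg, hg₀]
      exact le_max_left _ _
    rw [speedBound_of_ne_top htop]
    exact hX.ae_upperSpeed_le ho hone hgrowth
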